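/- Sets of natural numbers are identified with elements of $2^\omega$, and $Y \le_T Z$ means that (the characteristic function of) $Y$ is computable with oracle $Z$. A \emph{problem} is a partial function $P \colon 2^\omega \to \mathcal{P}(2^\omega)$; the elements of $\mathrm{dom}(P)$ are its instances and the elements of $P(x)$ are the solutions of the instance $x$. A problem $P$ is \emph{strongly omnisciently computably reducible} to a problem $Q$, written $P \leq_{soc} Q$, if for every $x \in \mathrm{dom}(P)$ there is some $\tilde{x} \in \mathrm{dom}(Q)$ such that for every $\tilde{y} \in Q(\tilde{x})$ there is some $y \leq_T \tilde{y}$ with $y \in P(x)$. Consider the following problems. - $\mathsf{SD}$: an instance is a set $A \subseteq \mathbb{N}$ of positive lower density, i.e. $\liminf_{n\to\infty} \frac{|A \cap \{0,\ldots,n\}|}{n+1} > 0$; a solution is an infinite subset of $A$. - $\mathsf{RT}^1_2$: an instance is a set $A \subseteq \mathbb{N}$; a solution is an infinite subset of $A$ or of $\mathbb{N} \setminus A$. - $\mathsf{RT}^1_{<\infty}$: an instance is (a code in $2^\omega$ for) a partition $A_1, \ldots, A_k$ of $\mathbb{N}$ into finitely many pieces; a solution is an infinite subset of some $A_i$. Theorem.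 1. $\mathsf{SD} \nleq_{soc} \mathsf{RT}^1_2$. 2. $\mathsf{SD} \nleq_{soc} \mathsf{RT}^1_{<\infty}$. 3. There are sets $A, G \subseteq \mathbb{N}$ such that $|A \cap \{0, \ldots, n\}| \geq \frac{1}{2}(n+1)$ for every $n \in \mathbb{N}$, $G$ is infinite, and no infinite subset of $G$ computes an infinite subset of $A$. -/

import Mathlib

namespace DenseCoding

open Filter

/-- The characteristic function of a set of natural numbers, as a (total) oracle. -/
noncomputable def chi (A : Set ℕ) : ℕ →. ℕ :=
  fun n => Part.some (A.indicator 1 n)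

/-- `B` computes `A`, i.e. `A ≤_T B`. -/
def Computes (B A : Set ℕ) : Prop :=
  TuringReducible (chi A) (chi B)

/-- The lower density `liminf |A ∩ {0, …, n}| / (n + 1)`. -/
noncomputable def lowerDensity (A : Set ℕ) : ℝ :=
  liminf (fun n : ℕ => ((A ∩ Set.Iic n).ncard : ℝ) / ((n : ℝ) + 1)) atTop

/-- `A` is `δ`-dense: `|A ∩ {0, …, n}| ≥ δ (n + 1)` for every `n`. -/
def IsDeltaDense (δ : ℝ) (A : Set ℕ) : Prop :=
  ∀ n : ℕ, δ * ((n : ℝ) + 1) ≤ ((A ∩ Set.Iic n).ncard : ℝ)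

/-- A problem is a partial function from `2^ω` to the power set of `2^ω`: the elements of its domain
are the instances, and its value at an instance is the set of solutions of that instance. -/
abbrev Problem : Type := Set ℕ →. Set (Set ℕ)

/-- Strong omniscient computable reducibility `P ≤_soc Q`. -/
def SOCReducible (P Q : Problem) : Prop :=
  ∀ (x : Set ℕ) (hx : x ∈ P.Dom), ∃ (x' : Set ℕ) (hx' : x' ∈ Q.Dom),
    ∀ y' ∈ Q.fn x' hx', ∃ y : Set ℕ, Computes y' y ∧ y ∈ P.fn x hx

/-- The problem `SD`: an instance is a set of positive lower density, a solution is an infinite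
subset of it. -/
def SD : Problem := fun A => ⟨0 < lowerDensity A, fun _ => {B | B.Infinite ∧ B ⊆ A}⟩

/-- The problem `RT^1_2`: every set `A` is an instance, a solution is an infinite subset of `A` or
of its complement. -/
def RT12 : Problem := fun A => ⟨True, fun _ => {B | B.Infinite ∧ (B ⊆ A ∨ B ⊆ Aᶜ)}⟩

/-- The `i`-th column of `x`, with respect to the pairing function `Nat.pair`. -/
def column (x : Set ℕ) (i : ℕ) : Set ℕ := {m | Nat.pair i m ∈ x}

/-- `x` codes a partition of `ℕ` into `k` pieces (some of which may be empty): column `0` of `x`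
is `{k}`, the columns `1, …, k` are the pieces, and all later columns are empty. -/
def CodesPartition (x : Set ℕ) (k : ℕ) : Prop :=
  column x 0 = {k} ∧ (∀ i, k < i → column x i = ∅) ∧
    ∀ m : ℕ, ∃! i : ℕ, 1 ≤ i ∧ i ≤ k ∧ m ∈ column x i

/-- The problem `RT^1_{<∞}`: an instance is a partition of `ℕ` into finitely many pieces, a solution
is an infinite set contained in one of the pieces. -/
def RT1Finite : Problem := fun x =>
  ⟨∃ k, CodesPartition x k, fun _ => {B | B.Infinite ∧ ∃ i, 1 ≤ i ∧ B ⊆ column x i}⟩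

end DenseCoding

namespace DenseCoding

/-! Each Turing functional has finite use, so the oracles on which it puts a given `n` into its
output form an open class, and open classes are Ramsey. A fusion therefore yields an infinite `G`
such that, once `C ∩ F` and `e` are fixed (`F` the first `i` elements of `G`, `e < i`), every
infinite `C ⊆ G` gives the same answer for each `n` below a bound `t (i + 1)`
(`exists_deciding_set`).

Only `2 ^ i * i` pairs `(C ∩ F, e)` occur at stage `i`. For each pair that forces some number `≥ t
i` into the output, one such number is left out of `A`; as `t` grows fast, `A` stays `1 / 2`-dense.
An infinite set computed from some `C ⊆ G` has an element in `[t i, t (i + 1))` for some `i > e`;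
this element is forced, so the set also contains an omitted number
(`exists_dense_set_not_computed`).

By pigeonhole every finite partition has a solution inside `G`, hence the two non-reductions. -/

/-! ### Oracle computations and finite use -/

/-- Every value of the functional `Φ` depends only on a finite part of its oracle. -/
def FiniteUse {α : Type} (Φ : Set ℕ → Part α) : Prop :=
  ∀ C a, a ∈ Φ C → ∃ k : ℕ, ∀ C' : Set ℕ, (∀ j < k, (j ∈ C ↔ j ∈ C')) → a ∈ Φ C'

theorem FiniteUse.const {α : Type} (p : Part α) : FiniteUse fun _ => p :=
  fun _ _ h => ⟨0, fun _ _ => h⟩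

theorem FiniteUse.bind {α β : Type} {Φ : Set ℕ → Part α} {Ψ : α → Set ℕ → Part β}
    (hΦ : FiniteUse Φ) (hΨ : ∀ a, FiniteUse (Ψ a)) :
    FiniteUse fun C => (Φ C).bind fun a => Ψ a C := by
  intro C b hb
  obtain ⟨a, ha, hb⟩ := Part.mem_bind_iff.1 hb
  obtain ⟨k, hk⟩ := hΦ C a ha
  obtain ⟨l, hl⟩ := hΨ a C b hb
  exact ⟨max k l, fun C' h => Part.mem_bind_iff.2
    ⟨a, hk C' fun j hj => h j (lt_max_of_lt_left hj), hl C' fun j hj => h j (lt_max_of_lt_right hj)⟩⟩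

theorem FiniteUse.map {α β : Type} {Φ : Set ℕ → Part α} (hΦ : FiniteUse Φ) (f : α → β) :
    FiniteUse fun C => (Φ C).map f := by
  simpa only [Part.bind_some_eq_map] using hΦ.bind fun a => FiniteUse.const (Part.some (f a))

theorem FiniteUse.rfind {p : ℕ → Set ℕ → Part Bool} (hp : ∀ n, FiniteUse (p n)) :
    FiniteUse fun C => Nat.rfind fun n => p n C := by
  intro C n hn
  obtain ⟨h1, h2⟩ := Nat.mem_rfind.1 hn
  obtain ⟨k, hk⟩ := hp n C true h1
  choose l hl using fun m (hm : m < n) => hp m C false (h2 hm)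
  refine ⟨max k ((Finset.range n).attach.sup fun m => l m.1 (Finset.mem_range.1 m.2)),
    fun C' h => Nat.mem_rfind.2 ⟨hk C' fun j hj => h j (lt_max_of_lt_left hj), fun {m} hm => ?_⟩⟩
  exact hl m hm C' fun j hj => h j <| lt_max_of_lt_right <| hj.trans_le <|
    Finset.le_sup (f := fun m : {x // x ∈ Finset.range n} => l m.1 (Finset.mem_range.1 m.2))
      (Finset.mem_attach _ ⟨m, Finset.mem_range.2 hm⟩)

theorem FiniteUse.natRec {Φ : Set ℕ → Part ℕ} {Ψ : ℕ → ℕ → Set ℕ → Part ℕ} (hΦ : FiniteUse Φ)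
    (hΨ : ∀ y i, FiniteUse (Ψ y i)) (n : ℕ) :
    FiniteUse fun C => n.rec (Φ C) fun y IH => IH.bind fun i => Ψ y i C := by
  induction n with
  | zero => exact hΦ
  | succ n ih => exact ih.bind (hΨ n)

theorem finiteUse_chi (n : ℕ) : FiniteUse fun C => chi C n := by
  intro C a ha
  refine ⟨n + 1, fun C' h => ?_⟩
  have := h n (Nat.lt_succ_self n)
  by_cases hn : n ∈ C
  · simpa [chi, hn, this.1 hn] using ha
  · simpa [chi, hn, mt this.2 hn] using ha

/-- Programs for partial functions that are recursive in an oracle. -/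
inductive OracleCode : Type
  | zero | succ | left | right | oracle
  | pair (c d : OracleCode)
  | comp (c d : OracleCode)
  | prec (c d : OracleCode)
  | rfind (c : OracleCode)

namespace OracleCode

/-- A Gödel numbering of the programs. -/
def encode : OracleCode → ℕ
  | zero => Nat.pair 0 0
  | succ => Nat.pair 0 1
  | left => Nat.pair 0 2
  | right => Nat.pair 0 3
  | oracle => Nat.pair 0 4
  | pair c d => Nat.pair 1 (Nat.pair c.encode d.encode)
  | comp c d => Nat.pair 2 (Nat.pair c.encode d.encode)
  | prec c d => Nat.pair 3 (Nat.pair c.encode d.encode)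
  | rfind c => Nat.pair 4 c.encode

theorem encode_injective : Function.Injective encode := by
  intro c
  induction c with
  | rfind c ih =>
    intro d h
    cases d <;> simp [encode, Nat.pair_eq_pair] at h ⊢
    exact ih h
  | pair c d ihc ihd | comp c d ihc ihd | prec c d ihc ihd =>
    intro d h
    cases d <;> simp [encode, Nat.pair_eq_pair] at h ⊢
    exact ⟨ihc h.1, ihd h.2⟩
  | _ =>
    intro d h
    cases d <;> simp [encode, Nat.pair_eq_pair] at h ⊢

instance : Countable OracleCode := encode_injective.countable

instance : Nonempty OracleCode := ⟨zero⟩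

/-- The partial function computed by a program with oracle `C`. -/
noncomputable def eval (C : Set ℕ) : OracleCode → ℕ →. ℕ
  | zero => fun _ => 0
  | succ => Nat.succ
  | left => fun n => (Nat.unpair n).1
  | right => fun n => (Nat.unpair n).2
  | oracle => chi C
  | pair c d => fun n => Nat.pair <$> eval C c n <*> eval C d n
  | comp c d => fun n => eval C d n >>= eval C c
  | prec c d => fun p =>
      let (a, n) := Nat.unpair p
      n.rec (eval C c a) fun y IH => do
        let i ← IH
        eval C d (Nat.pair a (Nat.pair y i))
  | rfind c => fun a => Nat.rfind fun n => (fun m => m = 0) <$> eval C c (Nat.pair a n)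

/-- `Nat.RecursiveIn` concerns one fixed oracle. A program acts on all oracles at once, and there
are only countably many programs. -/
theorem exists_eval_eq {C : Set ℕ} {f : ℕ →. ℕ} (hf : Nat.RecursiveIn {chi C} f) :
    ∃ c : OracleCode, c.eval C = f := by
  induction hf with
  | zero => exact ⟨zero, rfl⟩
  | succ => exact ⟨succ, rfl⟩
  | left => exact ⟨left, rfl⟩
  | right => exact ⟨right, rfl⟩
  | oracle g hg => exact ⟨oracle, (Set.mem_singleton_iff.1 hg).symm⟩
  | pair _ _ ihf ihh =>
    obtain ⟨⟨c, rfl⟩, ⟨d, rfl⟩⟩ := And.intro ihf ihh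
    exact ⟨pair c d, rfl⟩
  | comp _ _ ihf ihh =>
    obtain ⟨⟨c, rfl⟩, ⟨d, rfl⟩⟩ := And.intro ihf ihh
    exact ⟨comp c d, rfl⟩
  | prec _ _ ihf ihh =>
    obtain ⟨⟨c, rfl⟩, ⟨d, rfl⟩⟩ := And.intro ihf ihh
    exact ⟨prec c d, rfl⟩
  | rfind _ ih =>
    obtain ⟨c, rfl⟩ := ih
    exact ⟨rfind c, rfl⟩

theorem finiteUse_eval (c : OracleCode) (n : ℕ) : FiniteUse fun C => c.eval C n := by
  induction c generalizing n with
  | zero | succ | left | right => exact FiniteUse.const _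
  | oracle => exact finiteUse_chi n
  | pair c d ihc ihd =>
    simp only [eval, Seq.seq, Functor.map]
    exact ((ihc n).map Nat.pair).bind fun f => (ihd n).map f
  | comp c d ihc ihd => exact (ihd n).bind ihc
  | prec c d ihc ihd => exact (ihc _).natRec (fun _ _ => ihd _) _
  | rfind c ih => exact FiniteUse.rfind fun m => (ih _).map _

end OracleCode

/-- The Turing functionals, restricted to the question whether a number is put into the output, form
a countable family with the finite use property. -/
theorem exists_turing_family :
    ∃ Acc : ℕ → ℕ → Set (Set ℕ),
      (∀ e n C, C ∈ Acc e n → ∃ k : ℕ, ∀ C' : Set ℕ, (∀ j < k, (j ∈ C ↔ j ∈ C')) → C' ∈ Acc e n) ∧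
      ∀ C B, Computes C B → ∃ e, B = {n | C ∈ Acc e n} := by
  obtain ⟨φ, hφ⟩ := exists_surjective_nat OracleCode
  refine ⟨fun e n => {C | 1 ∈ (φ e).eval C n}, fun e n C h => (φ e).finiteUse_eval n C 1 h, ?_⟩
  intro C B h
  obtain ⟨c, hc⟩ := OracleCode.exists_eval_eq (RecursiveIn.iff_nat.1 h)
  obtain ⟨e, rfl⟩ := hφ c
  refine ⟨e, Set.ext fun n => ?_⟩
  by_cases hn : n ∈ B <;> simp [hc, chi, hn]

open Set

/-! ### Fusion -/

/-- The elements of `R` that lie above all elements of `F`. -/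
def above (F : Finset ℕ) (R : Set ℕ) : Set ℕ := {x ∈ R | ∀ y ∈ F, y < x}

theorem above_subset (F : Finset ℕ) (R : Set ℕ) : above F R ⊆ R := fun _ h => h.1

theorem above_mono (F : Finset ℕ) {R S : Set ℕ} (h : R ⊆ S) : above F R ⊆ above F S :=
  fun _ hx => ⟨h hx.1, hx.2⟩

theorem infinite_above (F : Finset ℕ) {R : Set ℕ} (hR : R.Infinite) : (above F R).Infinite := by
  refine (hR.sdiff (finite_Iic (F.sup id))).mono fun x hx => ⟨hx.1, fun y hy => ?_⟩
  exact (Finset.le_sup (f := id) hy).trans_lt (not_le.1 hx.2)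

theorem exists_subset_forall_mem {ι : Type} {P : ι → Set ℕ → Prop}
    (hmono : ∀ i R R', P i R → R' ⊆ R → R'.Infinite → P i R') (s : Finset ι)
    (hdense : ∀ i ∈ s, ∀ R : Set ℕ, R.Infinite → ∃ R' ⊆ R, R'.Infinite ∧ P i R')
    {R : Set ℕ} (hR : R.Infinite) : ∃ R' ⊆ R, R'.Infinite ∧ ∀ i ∈ s, P i R' := by
  classical
  induction s using Finset.induction_on with
  | empty => exact ⟨R, Subset.rfl, hR, by simp⟩
  | insert i s _ ih =>
    obtain ⟨R₁, h₁, hi₁, hP₁⟩ := ih fun j hj => hdense j (Finset.mem_insert_of_mem hj)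
    obtain ⟨R₂, h₂, hi₂, hP₂⟩ := hdense i (Finset.mem_insert_self i s) R₁ hi₁
    refine ⟨R₂, h₂.trans h₁, hi₂, fun j hj => ?_⟩
    rcases Finset.mem_insert.1 hj with rfl | hj
    · exact hP₂
    · exact hmono _ _ _ (hP₁ j hj) h₂ hi₂

/-- Fusion: a hereditary and dense property of conditions `(F, R)` can be made to hold for all finite
subsets of one infinite set at once. -/
theorem exists_fusion {P : Finset ℕ → Set ℕ → Prop}
    (hmono : ∀ F R R', P F R → R' ⊆ R → R'.Infinite → P F R')
    (hdense : ∀ F R, R.Infinite → ∃ R' ⊆ R, R'.Infinite ∧ P F R')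
    {R : Set ℕ} (hR : R.Infinite) :
    ∃ G ⊆ R, G.Infinite ∧ ∀ F : Finset ℕ, ↑F ⊆ G → P F (above F G) := by
  -- One step picks an element `q.1` of the reservoir and shrinks the reservoir to satisfy `P` for
  -- every finite set bounded by `q.1`.
  have hnext : ∀ p : {R : Set ℕ // R.Infinite}, ∃ q : ℕ × {R : Set ℕ // R.Infinite},
      q.1 ∈ p.1 ∧ q.2.1 ⊆ p.1 ∧ (∀ x ∈ q.2.1, q.1 < x) ∧
      ∀ F ∈ (Finset.range (q.1 + 1)).powerset, P F q.2.1 := by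
    rintro ⟨R, hR⟩
    obtain ⟨g, hg⟩ := hR.nonempty
    obtain ⟨R', h, hi, hP⟩ := exists_subset_forall_mem hmono
      (Finset.range (g + 1)).powerset (fun F _ => hdense F) (infinite_above {g} hR)
    exact ⟨(g, ⟨R', hi⟩), hg, h.trans (above_subset _ _), fun x hx => (h hx).2 g (by simp), hP⟩
  choose next hmem hsub hlt hP using hnext
  obtain ⟨R₀, h₀, hi₀, hP₀⟩ := hdense ∅ R hR
  let S : ℕ → {R : Set ℕ // R.Infinite} := fun n => n.rec ⟨R₀, hi₀⟩ fun _ p => (next p).2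
  let g : ℕ → ℕ := fun n => (next (S n)).1
  have hSanti : Antitone fun n => (S n).1 := antitone_nat_of_succ_le fun n => hsub (S n)
  have hgS : ∀ {n m}, n ≤ m → g m ∈ (S n).1 := fun h => hSanti h (hmem (S _))
  have hgmono : StrictMono g := strictMono_nat_of_lt_succ fun n => hlt (S n) _ (hgS (n := n + 1) le_rfl)
  have hG₀ : range g ⊆ R₀ := by
    rintro _ ⟨n, rfl⟩
    exact hgS (Nat.zero_le n)
  refine ⟨range g, hG₀.trans h₀, infinite_range_of_injective hgmono.injective, fun F hF => ?_⟩
  rcases F.eq_empty_or_nonempty with rfl | hne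
  · exact hmono _ _ _ hP₀ ((above_subset _ _).trans hG₀)
      (infinite_above _ (infinite_range_of_injective hgmono.injective))
  obtain ⟨n, hn⟩ := hF (F.max'_mem hne)
  refine hmono _ _ _ (hP (S n) F ?_) ?_
    (infinite_above _ (infinite_range_of_injective hgmono.injective))
  · refine Finset.mem_powerset.2 fun x hx => Finset.mem_range.2 (Nat.lt_succ_of_le ?_)
    exact (F.le_max' x hx).trans hn.ge
  · rintro _ ⟨⟨m, rfl⟩, hx⟩
    have : g n < g m := hn ▸ hx _ (F.max'_mem hne)
    exact hgS (n := n + 1) (hgmono.lt_iff_lt.1 this)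

/-! ### Ramsey property of open sets -/

/-- All sets `s ∪ X` with `X` an infinite subset of `R` belong to `O`. -/
def Accepts (O : Set (Set ℕ)) (s : Finset ℕ) (R : Set ℕ) : Prop :=
  ∀ X ⊆ R, X.Infinite → ↑s ∪ X ∈ O

theorem Accepts.mono {O : Set (Set ℕ)} {s : Finset ℕ} {R R' : Set ℕ} (h : Accepts O s R)
    (hR : R' ⊆ R) : Accepts O s R' := fun X hX => h X (hX.trans hR)

/-- No infinite subset of `R` accepts `s`. -/
def Rejects (O : Set (Set ℕ)) (s : Finset ℕ) (R : Set ℕ) : Prop :=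
  ∀ R' ⊆ R, R'.Infinite → ¬ Accepts O s R'

/-- The Ramsey property of open sets. -/
theorem exists_homogeneous_of_open {O : Set (Set ℕ)}
    (hO : ∀ C ∈ O, ∃ k : ℕ, ∀ C' : Set ℕ, (∀ j < k, (j ∈ C ↔ j ∈ C')) → C' ∈ O)
    {R : Set ℕ} (hR : R.Infinite) :
    ∃ R' ⊆ R, R'.Infinite ∧
      ((∀ C ⊆ R', C.Infinite → C ∈ O) ∨ ∀ C ⊆ R', C.Infinite → C ∉ O) := by
  obtain ⟨R₀, hR₀, hi₀, hdec⟩ := exists_fusion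
    (P := fun s R => Accepts O s R ∨ Rejects O s R)
    (fun F R R' h hsub _ => h.imp (fun h => h.mono hsub) fun h R'' h'' => h R'' (h''.trans hsub))
    (fun F R hR => by
      by_cases h : Rejects O F R
      · exact ⟨R, Subset.rfl, hR, Or.inr h⟩
      · simp only [Rejects, not_forall, not_not] at h
        obtain ⟨R', hsub, hi, h⟩ := h
        exact ⟨R', hsub, hi, Or.inl h⟩) hR
  by_cases hacc : Accepts O ∅ (above ∅ R₀)
  · refine ⟨R₀, hR₀, hi₀, Or.inl fun C hC hCi => ?_⟩
    simpa using hacc C (fun x hx => ⟨hC hx, by simp⟩) hCi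
  have hrej₀ := (hdec ∅ (by simp)).resolve_left hacc
  -- The second fusion makes rejection pass from `s` to its one-point end-extensions.
  obtain ⟨G, hG, hGi, hP⟩ := exists_fusion
    (P := fun s R => ↑s ⊆ R₀ → Rejects O s (above s R₀) →
      ∀ n ∈ above s (R ∩ R₀), Rejects O (insert n s) (above (insert n s) R₀))
    (fun F R R' h hsub _ h₁ h₂ n hn => h h₁ h₂ n (above_mono F (inter_subset_inter_left _ hsub) hn))
    (fun s R hR => by
      by_cases hs : ↑s ⊆ R₀ ∧ Rejects O s (above s R₀)
      · obtain ⟨hs, hrej⟩ := hs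
        set Bad := {n ∈ above s (R ∩ R₀) | ¬ Rejects O (insert n s) (above (insert n s) R₀)} with hBad
        have hBadsub : Bad ⊆ above s R₀ := fun n hn => above_mono s inter_subset_right hn.1
        -- If `Bad` were infinite it would accept `s`: for infinite `X ⊆ Bad` with minimum `n`, the
        -- set `insert n s` is not rejected, hence accepted, and `s ∪ X` is `insert n s ∪ (X \
        -- {n})`.
        have hfin : Bad.Finite := by
          by_contra hinf
          refine hrej Bad hBadsub hinf fun X hX hXi => ?_
          have hn := hX (Nat.sInf_mem hXi.nonempty)
          set n := sInf X
          have hns : (↑(insert n s) : Set ℕ) ⊆ R₀ := by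
            rw [Finset.coe_insert, insert_subset_iff]
            exact ⟨(hBadsub hn).1, hs⟩
          have := ((hdec _ hns).resolve_right hn.2) (X \ {n}) ?_ (hXi.sdiff (finite_singleton n))
          · rwa [Finset.coe_insert, insert_union, ← union_insert, insert_sdiff_singleton,
              insert_eq_of_mem (Nat.sInf_mem hXi.nonempty)] at this
          · intro x hx
            refine ⟨(hBadsub (hX hx.1)).1, fun y hy => ?_⟩
            rcases Finset.mem_insert.1 hy with rfl | hy
            · exact lt_of_le_of_ne (Nat.sInf_le hx.1) (Ne.symm hx.2)
            · exact (hBadsub (hX hx.1)).2 y hy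
        refine ⟨R \ Bad, sdiff_subset, hR.sdiff hfin, fun _ _ n hn => ?_⟩
        by_contra h
        exact hn.1.1.2 ⟨⟨⟨hn.1.1.1, hn.1.2⟩, hn.2⟩, h⟩
      · exact ⟨R, Subset.rfl, hR, fun h₁ h₂ => (hs ⟨h₁, h₂⟩).elim⟩) hi₀
  have hrej : ∀ s : Finset ℕ, ↑s ⊆ G → Rejects O s (above s R₀) := by
    intro s
    induction s using Finset.induction_on_max with
    | empty => exact fun _ => hrej₀
    | insert n s hs ih =>
      intro h
      rw [Finset.coe_insert, insert_subset_iff] at h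
      exact hP s h.2 (h.2.trans hG) (ih h.2) n ⟨⟨⟨h.1, hs⟩, hG h.1⟩, hs⟩
  refine ⟨G, hG.trans hR₀, hGi, Or.inr fun C hC hCi hCO => ?_⟩
  classical
  -- Openness enters here: with use `k`, the part of `G` beyond `k` would accept the rejected set `C
  -- ∩ [0, k)`.
  obtain ⟨k, hk⟩ := hO C hCO
  have hs : (↑((Finset.range k).filter (· ∈ C)) : Set ℕ) ⊆ G := fun x hx =>
    hC (Finset.mem_filter.1 hx).2
  refine hrej _ hs (above (Finset.range k) G) (fun x hx => ⟨hG hx.1, fun y hy => ?_⟩)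
    (infinite_above _ hGi) fun X hX _ => hk _ fun j hj => ?_
  · exact hx.2 y (Finset.mem_filter.1 hy).1
  · have : j ∉ X := fun h => lt_irrefl j ((hX h).2 j (Finset.mem_range.2 hj))
    simp [hj, this]

/-- An infinite set all of whose infinite subsets are decided by short initial segments, for a
countable family of open sets. -/
theorem exists_deciding_set {Acc : ℕ → ℕ → Set (Set ℕ)}
    (hAcc : ∀ e n, ∀ C ∈ Acc e n,
      ∃ k : ℕ, ∀ C' : Set ℕ, (∀ j < k, (j ∈ C ↔ j ∈ C')) → C' ∈ Acc e n) (t : ℕ → ℕ) :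
    ∃ G : Set ℕ, G.Infinite ∧ ∀ F : Finset ℕ, ↑F ⊆ G → ∀ E ⊆ F, ∀ e < F.card, ∀ n < t F.card,
      Accepts (Acc e n) E (above F G) ∨ Accepts (Acc e n)ᶜ E (above F G) := by
  obtain ⟨G, -, hG, hP⟩ := exists_fusion
    (P := fun F R => ∀ x ∈ F.powerset ×ˢ Finset.range F.card ×ˢ Finset.range (t F.card),
      Accepts (Acc x.2.1 x.2.2) x.1 R ∨ Accepts (Acc x.2.1 x.2.2)ᶜ x.1 R)
    (fun F R R' h hsub _ x hx => (h x hx).imp (fun h => h.mono hsub) fun h => h.mono hsub)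
    (fun F R hR => exists_subset_forall_mem
      (P := fun (x : Finset ℕ × ℕ × ℕ) R => Accepts (Acc x.2.1 x.2.2) x.1 R ∨ Accepts (Acc x.2.1 x.2.2)ᶜ x.1 R)
      (fun x R R' h hsub _ => h.imp (fun h => h.mono hsub) fun h => h.mono hsub) _
      (fun x _ R hR => exists_homogeneous_of_open (O := {X | (x.1 : Set ℕ) ∪ X ∈ Acc x.2.1 x.2.2})
        (fun C hC => by
          obtain ⟨k, hk⟩ := hAcc _ _ _ hC
          exact ⟨k, fun C' h => hk _ fun j hj => or_congr_right (h j hj)⟩) hR) hR)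
    infinite_univ
  refine ⟨G, hG, fun F hF E hE e he n hn => hP F hF (E, e, n) ?_⟩
  simpa using ⟨hE, he, hn⟩

/-! ### Construction of the dense set -/

theorem exists_le_lt_succ {t : ℕ → ℕ} (ht : StrictMono t) (h0 : t 0 = 0) (n : ℕ) :
    ∃ i, t i ≤ n ∧ n < t (i + 1) := by
  refine ⟨Nat.findGreatest (t · ≤ n) n, Nat.findGreatest_spec (P := (t · ≤ n)) (Nat.zero_le n)
    (h0.trans_le (Nat.zero_le n)), not_le.1 fun h => ?_⟩
  exact (Nat.le_findGreatest (P := (t · ≤ n)) ((ht.id_le _).trans h) h).not_gt (Nat.lt_succ_self _)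

/-- Removing at most `q i` numbers, all of them at least `2 * ∑ j ≤ i, q j`, for each `i` leaves a
`1 / 2`-dense set. -/
theorem isDeltaDense_half_of_sparse {q t : ℕ → ℕ} (ht : StrictMono t) (h0 : t 0 = 0)
    (htq : ∀ i, t i = 2 * ∑ j ∈ Finset.range (i + 1), q j) {D : ℕ → Finset ℕ}
    (hcard : ∀ i, (D i).card ≤ q i) (hD : ∀ i, ∀ n ∈ D i, t i ≤ n) :
    IsDeltaDense (1 / 2) {n | ∀ i, n ∉ D i} := by
  intro n
  obtain ⟨I, hI, hI'⟩ := exists_le_lt_succ ht h0 n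
  set A := {n | ∀ i, n ∉ D i}
  set U := (Finset.range (I + 1)).biUnion D
  have hU : 2 * U.card ≤ n := calc
    2 * U.card ≤ 2 * ∑ j ∈ Finset.range (I + 1), q j :=
      Nat.mul_le_mul_left 2 (Finset.card_biUnion_le.trans (Finset.sum_le_sum fun i _ => hcard i))
    _ ≤ n := (htq I).symm.trans_le hI
  have hsub : Iic n ⊆ (A ∩ Iic n) ∪ ↑U := by
    intro m hm
    by_cases hA : m ∈ A
    · exact Or.inl ⟨hA, hm⟩
    · obtain ⟨i, hi⟩ : ∃ i, m ∈ D i := by simpa [A] using hA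
      have : t i < t (I + 1) := ((hD i m hi).trans hm).trans_lt hI'
      exact Or.inr (Finset.mem_coe.2 (Finset.mem_biUnion.2
        ⟨i, Finset.mem_range.2 (ht.lt_iff_lt.1 this), hi⟩))
  have hle := (ncard_le_ncard hsub (((finite_Iic n).inter_of_right A).union U.finite_toSet)).trans
    (ncard_union_le _ _)
  rw [ncard_coe_finset, ← Finset.coe_Iic, ncard_coe_finset, Nat.card_Iic, Finset.coe_Iic] at hle
  have : n + 1 ≤ 2 * (A ∩ Iic n).ncard := by omega
  have : (n : ℝ) + 1 ≤ 2 * ((A ∩ Iic n).ncard : ℝ) := by exact_mod_cast this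
  linarith

theorem exists_dense_set_not_computed :
    ∃ A G : Set ℕ, IsDeltaDense (1 / 2) A ∧ G.Infinite ∧
      ∀ C : Set ℕ, C.Infinite → C ⊆ G →
        ∀ B : Set ℕ, B.Infinite → B ⊆ A → ¬ Computes C B := by
  classical
  obtain ⟨Acc, hAcc, hcomp⟩ := exists_turing_family
  set q : ℕ → ℕ := fun i => 2 ^ i * i with hq
  set t : ℕ → ℕ := fun i => 2 * ∑ j ∈ Finset.range (i + 1), q j with ht
  have ht0 : t 0 = 0 := by simp [ht, hq]
  have htmono : StrictMono t := strictMono_nat_of_lt_succ fun i => by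
    simp only [ht, Finset.sum_range_succ _ (i + 1)]
    have : 0 < q (i + 1) := by positivity
    omega
  -- The shift by one lets stage `i` decide the whole interval `[t i, t (i + 1))`.
  obtain ⟨G, hG, hdec⟩ := exists_deciding_set hAcc fun i => t (i + 1)
  set g := Nat.nth (· ∈ G)
  have hgmono : StrictMono g := Nat.nth_strictMono hG
  have hgG : ∀ i, g i ∈ G := Nat.nth_mem_of_infinite hG
  have hgsurj : ∀ x ∈ G, ∃ i, g i = x := fun x hx => ⟨_, Nat.nth_count hx⟩
  set F : ℕ → Finset ℕ := fun i => (Finset.range i).image g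
  have hFcard : ∀ i, (F i).card = i := fun i => by
    rw [Finset.card_image_of_injective _ hgmono.injective, Finset.card_range]
  have hFG : ∀ i, ↑(F i) ⊆ G := fun i x hx => by
    obtain ⟨j, -, rfl⟩ := Finset.mem_image.1 hx
    exact hgG j
  have hFabove : ∀ i, ∀ x ∈ G, x ∉ F i → x ∈ above (F i) G := fun i x hx hxF => by
    refine ⟨hx, fun y hy => ?_⟩
    obtain ⟨j, hj, rfl⟩ := Finset.mem_image.1 hy
    obtain ⟨m, rfl⟩ := hgsurj x hx
    refine hgmono ((Finset.mem_range.1 hj).trans_le (not_lt.1 fun hm => hxF ?_))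
    exact Finset.mem_image_of_mem g (Finset.mem_range.2 hm)
  -- `l` is a forced number `≥ t i` if one exists, and otherwise the harmless default `t i`. No
  -- upper bound on `l` is needed.
  have hL : ∀ i (x : Finset ℕ × ℕ), ∃ l, t i ≤ l ∧
      ∀ n, t i ≤ n → Accepts (Acc x.2 n) x.1 (above (F i) G) →
        Accepts (Acc x.2 l) x.1 (above (F i) G) := fun i x => by
    by_cases h : ∃ n, t i ≤ n ∧ Accepts (Acc x.2 n) x.1 (above (F i) G)
    · obtain ⟨l, hl, hacc⟩ := h
      exact ⟨l, hl, fun _ _ _ => hacc⟩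
    · exact ⟨t i, le_rfl, fun n hn hacc => (h ⟨n, hn, hacc⟩).elim⟩
  choose L htL hL using hL
  set D : ℕ → Finset ℕ := fun i => ((F i).powerset ×ˢ Finset.range i).image (L i)
  refine ⟨{n | ∀ i, n ∉ D i}, G, isDeltaDense_half_of_sparse htmono ht0 (fun _ => rfl)
    (fun i => Finset.card_image_le.trans ?_) ?_, hG, ?_⟩
  · rw [Finset.card_product, Finset.card_powerset, hFcard, Finset.card_range]
  · intro i n hn
    obtain ⟨x, -, rfl⟩ := Finset.mem_image.1 hn
    exact htL i x
  intro C hC hCG B hB hBA hCB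
  obtain ⟨e, rfl⟩ := hcomp C B hCB
  obtain ⟨b, hbB, hb⟩ := hB.exists_gt (t (e + 1))
  obtain ⟨i, hib, hbi⟩ := exists_le_lt_succ htmono ht0 b
  have hei : e < i := Nat.lt_of_succ_lt_succ (htmono.lt_iff_lt.1 (hb.trans hbi))
  set E := (F i).filter (· ∈ C) with hE
  have hEF : E ⊆ F i := Finset.filter_subset _ _
  have hCE : ↑E ∪ (C \ F i) = C := by
    ext x
    by_cases hx : x ∈ F i <;> simp [hE, hx]
  have hsub : C \ F i ⊆ above (F i) G := fun x hx => hFabove i x (hCG hx.1) hx.2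
  have hinf : (C \ F i).Infinite := hC.sdiff (F i).finite_toSet
  -- `C` itself puts `b` into the output, so the decision about `b` cannot be negative.
  have hacc : Accepts (Acc e b) E (above (F i) G) := by
    refine (hdec (F i) (hFG i) E hEF e (by rwa [hFcard]) b (by rwa [hFcard])).resolve_right
      fun h => h _ hsub hinf ?_
    rwa [hCE]
  have hl := hL i (E, e) b hib hacc _ hsub hinf
  rw [hCE] at hl
  exact hBA hl i (Finset.mem_image_of_mem _ (by simp [hEF, hei]))

/-! ### Lower density and the non-reductions -/

theorem IsDeltaDense.le_lowerDensity {δ : ℝ} {A : Set ℕ} (h : IsDeltaDense δ A) :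
    δ ≤ lowerDensity A := by
  refine Filter.le_liminf_of_le ?_ (Filter.Eventually.of_forall fun n => ?_)
  -- A real `liminf` is meaningful only for suitably bounded functions; the ratios are at most `1`.
  · refine Filter.IsCoboundedUnder.of_frequently_le (a := 1) (Filter.Frequently.of_forall fun n => ?_)
    rw [div_le_one (by positivity)]
    have := ncard_le_ncard (inter_subset_right (s := A) (t := Iic n)) (finite_Iic n)
    rw [← Finset.coe_Iic, ncard_coe_finset, Nat.card_Iic] at this
    exact_mod_cast this
  · rw [le_div_iff₀ (by positivity)]
    exact h n

/-- If every instance of `Q` has a solution inside any prescribed infinite set, then `SD` is not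
strongly omnisciently computably reducible to `Q`. -/
theorem not_socReducible_SD {Q : Problem}
    (hQ : ∀ (x : Set ℕ) (hx : x ∈ Q.Dom) (G : Set ℕ), G.Infinite →
      ∃ C ⊆ G, C.Infinite ∧ C ∈ Q.fn x hx) : ¬ SOCReducible SD Q := by
  obtain ⟨A, G, hA, hG, h⟩ := exists_dense_set_not_computed
  intro hred
  obtain ⟨x, hx, hred⟩ := hred A (show 0 < lowerDensity A from
    lt_of_lt_of_le (by norm_num) hA.le_lowerDensity)
  obtain ⟨C, hCG, hC, hCQ⟩ := hQ x hx G hG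
  obtain ⟨B, hCB, hB, hBA⟩ := hred C hCQ
  exact h C hC hCG B hB hBA hCB

theorem not_socReducible_SD_RT12 : ¬ SOCReducible SD RT12 := by
  refine not_socReducible_SD fun x hx G hG => ?_
  rw [← inter_union_compl G x, infinite_union] at hG
  rcases hG with hG | hG
  · exact ⟨_, inter_subset_left, hG, hG, Or.inl inter_subset_right⟩
  · exact ⟨_, inter_subset_left, hG, hG, Or.inr inter_subset_right⟩

theorem not_socReducible_SD_RT1Finite : ¬ SOCReducible SD RT1Finite := by
  refine not_socReducible_SD fun x hx G hG => ?_
  obtain ⟨k, -, -, hk⟩ := hx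
  have hcover : G ⊆ ⋃ i ∈ Icc 1 k, G ∩ column x i := fun m hm => by
    obtain ⟨i, ⟨h1, h2, h3⟩, -⟩ := hk m
    exact mem_biUnion (⟨h1, h2⟩ : i ∈ Icc 1 k) ⟨hm, h3⟩
  obtain ⟨i, hi, hinf⟩ : ∃ i ∈ Icc 1 k, (G ∩ column x i).Infinite := by
    by_contra! h
    exact hG (((finite_Icc 1 k).biUnion h).subset hcover)
  exact ⟨_, inter_subset_left, hinf, hinf, i, hi.1, inter_subset_right⟩

end DenseCoding

theorem mainTheorem6 :
    ¬ DenseCoding.SOCReducible DenseCoding.SD DenseCoding.RT12 ∧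
    ¬ DenseCoding.SOCReducible DenseCoding.SD DenseCoding.RT1Finite ∧
    ∃ A G : Set ℕ, DenseCoding.IsDeltaDense (1 / 2) A ∧ G.Infinite ∧
      ∀ C : Set ℕ, C.Infinite → C ⊆ G →
        ∀ B : Set ℕ, B.Infinite → B ⊆ A → ¬ DenseCoding.Computes C B := by
  exact ⟨DenseCoding.not_socReducible_SD_RT12, DenseCoding.not_socReducible_SD_RT1Finite,
    DenseCoding.exists_dense_set_not_computed⟩
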